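/- Let $N\ge 1$ and $R\ge 2$ be integers, let $F>0$, let $\phi\in C^2(0,\infty)$ be real-valued, and write $\phi''_{rF}=\phi''(rF)$. Identify $\mathbb{R}^N$ with the $N$-periodic real sequences $(u_\ell)_{\ell\in\mathbb{Z}}$, and define linear operators on $\mathbb{R}^N$ by $$(L^{\rm a}u)_\ell=\sum_{r=1}^R\phi''_{rF}\,(-u_{\ell+r}+2u_\ell-u_{\ell-r}),\qquad (L^{\rm c}u)_\ell=\sum_{r=1}^R r^2\phi''_{rF}\,(-u_{\ell+1}+2u_\ell-u_{\ell-1}).$$ Let $\mathcal A\subset\{1,\dots,N\}$ be arbitrary and $\mathcal C=\{1,\dots,N\}\setminus\mathcal A$. Let $(L^{\rm qcf}u)_\ell=(L^{\rm a}u)_\ell$ for $\ell\in\mathcal A$ and $(L^{\rm qcf}u)_\ell=(L^{\rm c}u)_\ell$ for $\ell\in\mathcal C$, and let $L^{\rm qcf}_0=P_{\mathcal U}L^{\rm qcf}$, where $(P_{\mathcal U}u)_\ell=u_\ell-\frac1N\sum_{k=1}^N u_k$. Put, for $t\in\mathbb{C}\setminus\{0\}$, $$b(t)=\sum_{r=2}^R\phi''_{rF}\big[(t^r-1)(t^{-r}-1)-r^2(t-1)(t^{-1}-1)\big],\qquad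 b_1(t)=\frac{b(t)}{[(t-1)(t^{-1}-1)]^2},$$ where $b_1(1)$ is understood as the limit $\lim_{t\to1}b_1(t)$, which exists; $b$ is real on the unit circle. Suppose that there are constants $\beta_0,\beta_1>0$ such that $$\beta_0^2\le|b_1(t)|\le\beta_1^2\qquad\text{for all } t\in\mathbb{C},\ |t|=1.$$ Then all eigenvalues of $L^{\rm qcf}_0$ are real. Let $\lambda_1\le\dots\le\lambda_N$, $\lambda^{\rm a}_1\le\dots\le\lambda^{\rm a}_N$ and $\lambda^{\rm c}_1\le\dots\le\lambda^{\rm c}_N$ be the eigenvalues of $L^{\rm qcf}_0$, $L^{\rm a}$ and $L^{\rm c}$, respectively, counted with algebraic multiplicity (those of the symmetric operators $L^{\rm a}$ and $L^{\rm c}$ are real as well). Then $$\lambda^{\rm c}_j\le\lambda_j\le\lambda^{\rm a}_j\quad(j=1,\dots,N)\qquad\text{if } b(t)\ge0 \text{ for all } |t|=1,$$ $$\lambda^{\rm a}_j\le\lambda_j\le\lambda^{\rm c}_j\quad(j=1,\dots,N)\qquad\text{if } b(t)\le0 \text{ for all } |t|=1.$$ -/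

import Mathlib

open Filter Topology

noncomputable section

namespace QCF

/-- `N`-periodic real sequences, i.e. real functions on `ℤ / Nℤ`. -/
abbrev Per (N : ℕ) : Type := ZMod N → ℝ

/-- The coefficient `φ''(r F)`. -/
def phi2 (φ : ℝ → ℝ) (F : ℝ) (r : ℕ) : ℝ := deriv (deriv φ) ((r : ℝ) * F)

/-- The linearized atomistic operator,
`(Lᵃ u)_ℓ = ∑_{r=1}^R φ''(rF) (-u_{ℓ+r} + 2 u_ℓ - u_{ℓ-r})`. -/
def La (N R : ℕ) (φ : ℝ → ℝ) (F : ℝ) : Per N →ₗ[ℝ] Per N where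
  toFun u := fun l => ∑ r ∈ Finset.Icc 1 R,
    phi2 φ F r * (-u (l + (r : ZMod N)) + 2 * u l - u (l - (r : ZMod N)))
  map_add' u v := by
    funext l
    simp only [Pi.add_apply, ← Finset.sum_add_distrib]
    exact Finset.sum_congr rfl fun r _ => by ring
  map_smul' c u := by
    funext l
    simp only [Pi.smul_apply, smul_eq_mul, RingHom.id_apply, Finset.mul_sum]
    exact Finset.sum_congr rfl fun r _ => by ring

/-- The linearized continuum (Cauchy-Born) operator,
`(Lᶜ u)_ℓ = ∑_{r=1}^R φ''(rF) r² (-u_{ℓ+1} + 2 u_ℓ - u_{ℓ-1})`. -/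
def Lc (N R : ℕ) (φ : ℝ → ℝ) (F : ℝ) : Per N →ₗ[ℝ] Per N where
  toFun u := fun l => ∑ r ∈ Finset.Icc 1 R,
    phi2 φ F r * (r : ℝ) ^ 2 * (-u (l + 1) + 2 * u l - u (l - 1))
  map_add' u v := by
    funext l
    simp only [Pi.add_apply, ← Finset.sum_add_distrib]
    exact Finset.sum_congr rfl fun r _ => by ring
  map_smul' c u := by
    funext l
    simp only [Pi.smul_apply, smul_eq_mul, RingHom.id_apply, Finset.mul_sum]
    exact Finset.sum_congr rfl fun r _ => by ring

open scoped Classical in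
/-- The force-based quasicontinuum operator: `(L u)_ℓ = (Lᵃ u)_ℓ` on the atomistic region `A`,
and `(L u)_ℓ = (Lᶜ u)_ℓ` on the continuum region, the complement of `A`. -/
def Lqcf (N R : ℕ) (φ : ℝ → ℝ) (F : ℝ) (A : Set (ZMod N)) : Per N →ₗ[ℝ] Per N where
  toFun u := fun l => if l ∈ A then La N R φ F u l else Lc N R φ F u l
  map_add' u v := by
    funext l
    by_cases h : l ∈ A <;> simp [h]
  map_smul' c u := by
    funext l
    by_cases h : l ∈ A <;> simp [h]

/-- The orthogonal projection onto mean-zero periodic sequences,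
`(P u)_ℓ = u_ℓ - (1/N) ∑_k u_k`. -/
def PU (N : ℕ) [NeZero N] : Per N →ₗ[ℝ] Per N where
  toFun u := fun l => u l - (1 / (N : ℝ)) * ∑ k, u k
  map_add' u v := by
    funext l
    simp only [Pi.add_apply, Finset.sum_add_distrib]
    ring
  map_smul' c u := by
    funext l
    simp only [Pi.smul_apply, smul_eq_mul, RingHom.id_apply, ← Finset.mul_sum]
    ring

/-- The projected force-based quasicontinuum operator. -/
def Lqcf0 (N : ℕ) [NeZero N] (R : ℕ) (φ : ℝ → ℝ) (F : ℝ) (A : Set (ZMod N)) :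
    Per N →ₗ[ℝ] Per N :=
  PU N ∘ₗ Lqcf N R φ F A

/-- The Laurent polynomial `b`, as a function of `t ≠ 0`:
`b(t) = ∑_{r=2}^R φ''(rF) [(t^r - 1)(t^{-r} - 1) - r² (t - 1)(t⁻¹ - 1)]`. -/
def b (R : ℕ) (φ : ℝ → ℝ) (F : ℝ) (t : ℂ) : ℂ :=
  ∑ r ∈ Finset.Icc 2 R, (phi2 φ F r : ℂ) *
    ((t ^ r - 1) * (t⁻¹ ^ r - 1) - (r : ℂ) ^ 2 * ((t - 1) * (t⁻¹ - 1)))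

/-- The quotient `b(t) / [(t - 1)(t⁻¹ - 1)]²`, meaningful for `t ≠ 0, 1`. -/
def bQuot (R : ℕ) (φ : ℝ → ℝ) (F : ℝ) (t : ℂ) : ℂ :=
  b R φ F t / ((t - 1) * (t⁻¹ - 1)) ^ 2

/-- The Laurent polynomial `b₁(t) = b(t) / [(t - 1)(t⁻¹ - 1)]²`; its value at the removable
singularity `t = 1` is the limit of the quotient, which exists by `tendsto_bQuot`. -/
def b1 (R : ℕ) (φ : ℝ → ℝ) (F : ℝ) : ℂ → ℂ :=
  Function.update (bQuot R φ F) 1 (limUnder (𝓝[≠] (1 : ℂ)) (bQuot R φ F))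

theorem exists_quot (r : ℕ) : ∃ q : ℂ → ℂ, Continuous q ∧ ∀ t : ℂ, t ≠ 0 →
    (t ^ r - 1) * (t⁻¹ ^ r - 1) - (r : ℂ) ^ 2 * ((t - 1) * (t⁻¹ - 1)) =
      ((t - 1) * (t⁻¹ - 1)) ^ 2 * q ((t - 1) * (t⁻¹ - 1)) := by
  induction r using Nat.twoStepInduction with
  | zero => exact ⟨0, continuous_const, fun t _ => by simp⟩
  | one => exact ⟨0, continuous_const, fun t _ => by simp⟩
  | more r h0 h1 =>
    obtain ⟨q0, c0, e0⟩ := h0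
    obtain ⟨q1, c1, e1⟩ := h1
    refine ⟨fun s => 2 * q1 s - q0 s - s * q1 s - ((r : ℂ) + 1) ^ 2, by fun_prop, ?_⟩
    intro t ht
    have e0 := e0 t ht
    have e1 := e1 t ht
    have hm : t * t⁻¹ = 1 := mul_inv_cancel₀ ht
    have hp : t ^ r * t⁻¹ ^ r = 1 := by rw [← mul_pow, hm, one_pow]
    have hp1 : t ^ (r + 1) * t⁻¹ ^ (r + 1) = 1 := by rw [← mul_pow, hm, one_pow]
    have hp2 : t ^ (r + 2) * t⁻¹ ^ (r + 2) = 1 := by rw [← mul_pow, hm, one_pow]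
    have hs : (t - 1) * (t⁻¹ - 1) = 2 - t - t⁻¹ := by linear_combination hm
    rw [hs] at e0 e1 ⊢
    have f0 : (t ^ r - 1) * (t⁻¹ ^ r - 1) = 2 - t ^ r - t⁻¹ ^ r := by linear_combination hp
    have f1 : (t ^ (r + 1) - 1) * (t⁻¹ ^ (r + 1) - 1) = 2 - t ^ (r + 1) - t⁻¹ ^ (r + 1) := by
      linear_combination hp1
    have f2 : (t ^ (r + 2) - 1) * (t⁻¹ ^ (r + 2) - 1) = 2 - t ^ (r + 2) - t⁻¹ ^ (r + 2) := by
      linear_combination hp2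
    rw [f0] at e0
    rw [f1] at e1
    rw [f2]
    have g1 : t ^ (r + 2) = t ^ (r + 1) * t := pow_succ _ _
    have g2 : t⁻¹ ^ (r + 2) = t⁻¹ ^ (r + 1) * t⁻¹ := pow_succ _ _
    have g3 : t ^ (r + 1) * t⁻¹ = t ^ r := by rw [pow_succ, mul_assoc, hm, mul_one]
    have g4 : t⁻¹ ^ (r + 1) * t = t⁻¹ ^ r := by
      rw [pow_succ, mul_assoc, mul_comm t⁻¹ t, hm, mul_one]
    push_cast at *
    linear_combination (2 - (2 - t - t⁻¹)) * e1 - e0 - g1 - g2 + g3 + g4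

/-- The singularity of the quotient at `t = 1` is removable. -/
theorem tendsto_bQuot (R : ℕ) (φ : ℝ → ℝ) (F : ℝ) :
    Tendsto (bQuot R φ F) (𝓝[≠] (1 : ℂ)) (𝓝 (b1 R φ F 1)) := by
  choose q hq he using exists_quot
  have h : Tendsto (fun t : ℂ => ∑ r ∈ Finset.Icc 2 R, (phi2 φ F r : ℂ) *
      q r ((t - 1) * (t⁻¹ - 1))) (𝓝[≠] (1 : ℂ))
      (𝓝 (∑ r ∈ Finset.Icc 2 R, (phi2 φ F r : ℂ) * q r (((1 : ℂ) - 1) * ((1 : ℂ)⁻¹ - 1)))) := by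
    refine tendsto_finsetSum _ fun r _ => Tendsto.const_mul _ ?_
    refine ((hq r).tendsto _).comp ?_
    refine Tendsto.mono_left ?_ nhdsWithin_le_nhds
    exact ((continuous_id.tendsto (1 : ℂ)).sub_const 1).mul
      ((tendsto_inv₀ one_ne_zero).sub_const 1)
  have hlim : ∃ y, Tendsto (bQuot R φ F) (𝓝[≠] (1 : ℂ)) (𝓝 y) := by
    refine ⟨_, h.congr' ?_⟩
    have h0 : ∀ᶠ t : ℂ in 𝓝[≠] (1 : ℂ), t ≠ 0 :=
      nhdsWithin_le_nhds (isOpen_ne.mem_nhds one_ne_zero)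
    filter_upwards [h0, self_mem_nhdsWithin] with t ht ht1
    have hs : (t - 1) * (t⁻¹ - 1) ≠ 0 :=
      mul_ne_zero (sub_ne_zero.2 ht1) (sub_ne_zero.2 fun h => ht1 (inv_eq_one.1 h))
    unfold bQuot b
    rw [eq_div_iff (pow_ne_zero 2 hs), Finset.sum_mul]
    refine Finset.sum_congr rfl fun r _ => ?_
    rw [he r t ht]
    ring
  rw [b1, Function.update_self]
  exact tendsto_nhds_limUnder hlim

/-- `b` is real on the unit circle. -/
theorem b_im (R : ℕ) (φ : ℝ → ℝ) (F : ℝ) (t : ℂ) (ht : ‖t‖ = 1) : (b R φ F t).im = 0 := by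
  rw [← Complex.conj_eq_iff_im]
  have h : (starRingEnd ℂ) t = t⁻¹ := (Complex.inv_eq_conj ht).symm
  simp only [b, map_sum, map_mul, map_sub, map_pow, map_inv₀, map_one, Complex.conj_ofReal,
    map_natCast, h, inv_inv]
  exact Finset.sum_congr rfl fun r _ => by ring

/-- `ev` lists all eigenvalues of `M`, repeated according to their (algebraic) multiplicity and
in increasing order; in particular the whole complex spectrum of `M` is real. -/
def IsOrderedSpectrum {N : ℕ} [NeZero N] (M : Per N →ₗ[ℝ] Per N) (ev : Fin N → ℝ) : Prop :=
  Monotone ev ∧ M.charpoly = ∏ j, (Polynomial.X - Polynomial.C (ev j))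

end QCF

end

/-! Write `B` for the matrix of `Lᵃ - Lᶜ`, `J` for the projection onto constants, `χ` for the
indicator of `A`. The DFT turns `B` into multiplication by `b` at the `N`-th roots of unity. As `b`
is real and has no zero on the circle off `1`, connectedness gives it one sign `ε = ±1` there, so `G
= ε B + J` is positive definite (`posDef_circulant`). Since `B J = 0` and `J² = J`, `G (1 - J) = ε
B`; hence `G L₀ = ε (B Lᶜ + B χ B)`, while `G Lᵃ = ε B Lᵃ` and `G Lᶜ = ε B Lᶜ`. All three are
symmetric, because circulants commute, so the operators are self-adjoint for the inner product of
`G` and their spectra are real. The forms differ by `ε B χ B` and `ε B (1 - χ) B`, which have the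
sign of `ε`, and Weyl's monotonicity principle orders the eigenvalues (`exists_isOrderedSpectrum`).
-/

namespace LinearMap.IsSymmetric

/-! ### Weyl's monotonicity principle -/

variable {E : Type*} [NormedAddCommGroup E] [InnerProductSpace ℝ E] [FiniteDimensional ℝ E]

theorem inner_apply_self_eq_sum {T : E →ₗ[ℝ] E} (hT : T.IsSymmetric) {n : ℕ}
    (hn : Module.finrank ℝ E = n) (x : E) :
    inner ℝ x (T x) =
      ∑ i, hT.eigenvalues hn i * inner ℝ (hT.eigenvectorBasis hn i) x ^ 2 := by
  rw [← (hT.eigenvectorBasis hn).sum_inner_mul_inner]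
  refine Finset.sum_congr rfl fun i _ => ?_
  rw [← hT, hT.apply_eigenvectorBasis hn i, inner_smul_left, real_inner_comm]
  simp only [RCLike.ofReal_real_eq_id, id_eq, conj_trivial]
  ring

/-- Weyl's monotonicity principle. -/
theorem eigenvalues_le_eigenvalues {S T : E →ₗ[ℝ] E} (hS : S.IsSymmetric) (hT : T.IsSymmetric)
    {n : ℕ} (hn : Module.finrank ℝ E = n) (h : ∀ x, inner ℝ x (S x) ≤ inner ℝ x (T x))
    (j : Fin n) : hS.eigenvalues hn j ≤ hT.eigenvalues hn j := by
  set u := hS.eigenvectorBasis hn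
  set w := hT.eigenvectorBasis hn
  -- These are `n - 1` functionals on an `n`-dimensional space. A nonzero common zero lies in the
  -- span of the `u i` with `i ≤ j` and of the `w i` with `j ≤ i`; eigenvalues are listed in
  -- decreasing order.
  let f : E →ₗ[ℝ] ({i : Fin n // i ≠ j} → ℝ) := LinearMap.pi fun i =>
    if j < i.1 then (innerSL ℝ (u i.1)).toLinearMap else (innerSL ℝ (w i.1)).toLinearMap
  have hker : f.ker ≠ ⊥ := by
    apply f.ker_ne_bot_of_finrank_lt
    have := j.pos
    simp only [Module.finrank_fintype_fun_eq_card, hn, ne_eq, Fintype.card_subtype_compl,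
      Fintype.card_fin, Fintype.card_subtype_eq]
    omega
  obtain ⟨x, hx, hx0⟩ := Submodule.exists_mem_ne_zero_of_ne_bot hker
  have hf : ∀ i (hi : i ≠ j), f x ⟨i, hi⟩ = 0 := fun i hi => congrFun hx _
  have hu : ∀ i, j < i → inner ℝ (u i) x = 0 := fun i hi => by
    simpa [f, hi] using hf i hi.ne'
  have hw : ∀ i, i < j → inner ℝ (w i) x = 0 := fun i hi => by
    simpa [f, hi.not_gt] using hf i hi.ne
  have hnorm (b : OrthonormalBasis (Fin n) ℝ E) : ∑ i, inner ℝ (b i) x ^ 2 = inner ℝ x x := by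
    rw [← b.sum_inner_mul_inner x x]
    exact Finset.sum_congr rfl fun i _ => by rw [real_inner_comm x, sq]
  have h1 : hS.eigenvalues hn j * inner ℝ x x ≤ inner ℝ x (S x) := by
    rw [hS.inner_apply_self_eq_sum hn, ← hnorm u, Finset.mul_sum]
    refine Finset.sum_le_sum fun i _ => ?_
    rcases le_or_gt i j with hij | hij
    · exact mul_le_mul_of_nonneg_right (hS.eigenvalues_antitone hn hij) (sq_nonneg _)
    · change _ ≤ _ * inner ℝ (u i) x ^ 2
      simp [hu i hij]
  have h2 : inner ℝ x (T x) ≤ hT.eigenvalues hn j * inner ℝ x x := by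
    rw [hT.inner_apply_self_eq_sum hn, ← hnorm w, Finset.mul_sum]
    refine Finset.sum_le_sum fun i _ => ?_
    rcases le_or_gt j i with hij | hij
    · exact mul_le_mul_of_nonneg_right (hT.eigenvalues_antitone hn hij) (sq_nonneg _)
    · change _ * inner ℝ (w i) x ^ 2 ≤ _
      simp [hw i hij]
  exact le_of_mul_le_mul_right (h1.trans ((h x).trans h2)) (real_inner_self_pos.2 hx0)

end LinearMap.IsSymmetric

/-! ### Operators self-adjoint for a weighted inner product -/

open Matrix

open scoped MatrixOrder in
theorem Matrix.PosDef.exists_eq_conjTranspose_mul_self {n : Type*} [Fintype n]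
    [DecidableEq n] {G : Matrix n n ℝ} (hG : G.PosDef) : ∃ C : (Matrix n n ℝ)ˣ, G = C.1ᴴ * C.1 := by
  obtain ⟨C, hC⟩ := CStarAlgebra.nonneg_iff_eq_star_mul_self.mp hG.posSemidef.nonneg
  have hu : IsUnit C := by
    have := hG.isUnit
    rw [hC, Matrix.isUnit_iff_isUnit_det, det_mul] at this
    exact (Matrix.isUnit_iff_isUnit_det C).2 (isUnit_of_mul_isUnit_right this)
  exact ⟨hu.unit, hC⟩

namespace QCF

/-- Operators that are self-adjoint with respect to the inner product given by a positive definite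
matrix `G` have real spectrum, and the ordered eigenvalues are monotone with respect to the
quadratic forms. -/
theorem exists_isOrderedSpectrum {N : ℕ} [NeZero N] {ι : Type*} {G : Matrix (ZMod N) (ZMod N) ℝ}
    (hG : G.PosDef) (M : ι → Per N →ₗ[ℝ] Per N)
    (hM : ∀ i, (G * LinearMap.toMatrix' (M i)).IsHermitian) :
    ∃ ev : ι → Fin N → ℝ, (∀ i, IsOrderedSpectrum (M i) (ev i)) ∧
      ∀ i j, (G * LinearMap.toMatrix' (M j) - G * LinearMap.toMatrix' (M i)).PosSemidef →
        ∀ k, ev i k ≤ ev j k := by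
  obtain ⟨C, rfl⟩ := hG.exists_eq_conjTranspose_mul_self
  set D : Matrix (ZMod N) (ZMod N) ℝ := (C⁻¹).1
  have hD : Dᴴ * C.1ᴴ = 1 := by rw [← conjTranspose_mul, C.mul_inv, conjTranspose_one]
  -- Conjugation by `C` keeps the spectrum and carries the inner product of `G` to the Euclidean
  -- one.
  let S (i : ι) : Matrix (ZMod N) (ZMod N) ℝ := C.1 * LinearMap.toMatrix' (M i) * D
  have hS (i : ι) : S i = Dᴴ * (C.1ᴴ * C.1 * LinearMap.toMatrix' (M i)) * D := by
    calc S i = (Dᴴ * C.1ᴴ) * (C.1 * LinearMap.toMatrix' (M i) * D) := by rw [hD, one_mul]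
      _ = _ := by simp only [mul_assoc]
  have hsymm (i : ι) : (toEuclideanLin (S i)).IsSymmetric := by
    rw [isSymmetric_toEuclideanLin_iff, hS]
    exact isHermitian_conjTranspose_mul_mul _ (hM i)
  have hn : Module.finrank ℝ (EuclideanSpace ℝ (ZMod N)) = N := by
    rw [finrank_euclideanSpace, ZMod.card]
  -- `k.rev` turns the decreasing list into an increasing one.
  refine ⟨fun i k => (hsymm i).eigenvalues hn k.rev, fun i => ⟨?_, ?_⟩, fun i j hij k => ?_⟩
  · exact fun a b hab => (hsymm i).eigenvalues_antitone hn (Fin.rev_le_rev.2 hab)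
  · have h1 : (toEuclideanLin (S i)).charpoly = (M i).charpoly := by
      rw [toEuclideanLin, toLpLin_eq_toLin, Matrix.charpoly_toLin]
      simp only [S, D]
      rw [Matrix.coe_units_inv, Matrix.charpoly_units_conj,
        ← LinearMap.toMatrix_eq_toMatrix', LinearMap.charpoly_toMatrix]
    rw [← h1, (hsymm i).charpoly_eq hn]
    exact (Equiv.prod_comp Fin.revPerm _).symm
  · refine (hsymm i).eigenvalues_le_eigenvalues (hsymm j) hn (fun x => ?_) _
    have h2 := (hij.conjTranspose_mul_mul_same D).dotProduct_mulVec_nonneg (WithLp.ofLp x)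
    rw [mul_sub, sub_mul, ← hS, ← hS, sub_mulVec, dotProduct_sub, sub_nonneg] at h2
    simpa only [EuclideanSpace.inner_eq_star_dotProduct, ofLp_toLpLin, toLin'_apply,
      dotProduct_comm (WithLp.ofLp x), star_trivial] using h2

/-! ### Circulant matrices and their Fourier symbols -/

theorem La_single_neg {N : ℕ} (R : ℕ) (φ : ℝ → ℝ) (F : ℝ) (k : ZMod N) :
    La N R φ F (Pi.single 0 1) (-k) = La N R φ F (Pi.single 0 1) k := by
  simp only [La, LinearMap.coe_mk, AddHom.coe_mk, Pi.single_apply]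
  refine Finset.sum_congr rfl fun r _ => ?_
  have h1 : -k + (r : ZMod N) = 0 ↔ k - r = 0 := by rw [← neg_eq_zero]; ring_nf
  have h2 : -k - (r : ZMod N) = 0 ↔ k + r = 0 := by rw [← neg_eq_zero]; ring_nf
  simp only [h1, h2, neg_eq_zero]
  ring

theorem Lc_single_neg {N : ℕ} (R : ℕ) (φ : ℝ → ℝ) (F : ℝ) (k : ZMod N) :
    Lc N R φ F (Pi.single 0 1) (-k) = Lc N R φ F (Pi.single 0 1) k := by
  simp only [Lc, LinearMap.coe_mk, AddHom.coe_mk, Pi.single_apply]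
  refine Finset.sum_congr rfl fun r _ => ?_
  have h1 : -k + 1 = 0 ↔ k - 1 = 0 := by rw [← neg_eq_zero]; ring_nf
  have h2 : -k - 1 = 0 ↔ k + 1 = 0 := by rw [← neg_eq_zero]; ring_nf
  simp only [h1, h2, neg_eq_zero]
  ring

variable {N : ℕ} [NeZero N]

/-- By the convolution theorem, an eigenvector whose transform is nonzero at `k` has eigenvalue
`ĝ(k)`, so every eigenvalue is a value of the transform of `g`. -/
theorem posDef_circulant {g : ZMod N → ℝ} (hg : ∀ k, g (-k) = g k)
    (hpos : ∀ k, 0 < (ZMod.dft (fun l => (g l : ℂ)) k).re) : (circulant g).PosDef := by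
  have hH : (circulant g).IsHermitian := by
    rw [IsHermitian, conjTranspose_eq_transpose_of_trivial]
    exact circulant_isSymm_iff.2 hg
  rw [hH.posDef_iff_eigenvalues_pos]
  intro i
  have hv := hH.mulVec_eigenvectorBasis i
  have hv0 : hH.eigenvectorBasis i ≠ 0 := hH.eigenvectorBasis.orthonormal.ne_zero i
  set v : ZMod N → ℝ := (hH.eigenvectorBasis i).ofLp with hvdef
  set μ := hH.eigenvalues i
  have hne : ZMod.dft (fun l => (v l : ℂ)) ≠ 0 := by
    rw [Ne, LinearEquiv.map_eq_zero_iff]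
    refine fun h => hv0 ?_
    ext l
    exact Complex.ofReal_eq_zero.1 (congrFun h l)
  obtain ⟨k, hk⟩ := Function.ne_iff.1 hne
  have hconv : ZMod.dft (fun l => ((circulant g *ᵥ v) l : ℂ)) k =
      ZMod.dft (fun l => (g l : ℂ)) k * ZMod.dft (fun l => (v l : ℂ)) k := by
    simp only [ZMod.dft_apply, mulVec, dotProduct, circulant_apply, smul_eq_mul,
      Complex.ofReal_sum, Complex.ofReal_mul, Finset.mul_sum]
    rw [Finset.sum_comm]
    refine Finset.sum_congr rfl fun j _ => ?_
    symm
    rw [Finset.sum_mul, ← (Equiv.subRight j).sum_comp]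
    refine Finset.sum_congr rfl fun l _ => ?_
    rw [Equiv.subRight_apply, show -(l * k) = -((l - j) * k) + -(j * k) by ring,
      AddChar.map_add_eq_mul]
    ring
  have hscal : ZMod.dft (fun l => ((circulant g *ᵥ v) l : ℂ)) k =
      (μ : ℂ) * ZMod.dft (fun l => (v l : ℂ)) k := by
    have h1 : (fun l => ((circulant g *ᵥ v) l : ℂ)) = (μ : ℂ) • fun l => (v l : ℂ) := by
      funext l
      simp [hv]
    rw [h1, map_smul, Pi.smul_apply, smul_eq_mul]
  have := hpos k
  rwa [mul_right_cancel₀ hk (hconv.symm.trans hscal), Complex.ofReal_re] at this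

theorem toMatrix'_La (R : ℕ) (φ : ℝ → ℝ) (F : ℝ) :
    LinearMap.toMatrix' (La N R φ F) = circulant (La N R φ F (Pi.single 0 1)) := by
  ext i j
  rw [LinearMap.toMatrix'_apply, circulant_apply]
  simp only [La, LinearMap.coe_mk, AddHom.coe_mk, Pi.single_apply]
  refine Finset.sum_congr rfl fun r _ => ?_
  have h1 : i + (r : ZMod N) = j ↔ i - j + r = 0 := by
    rw [← sub_eq_zero, add_sub_right_comm]
  have h2 : i - (r : ZMod N) = j ↔ i - j - r = 0 := by
    rw [← sub_eq_zero, sub_right_comm]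
  simp only [h1, h2, sub_eq_zero (a := i) (b := j)]

theorem toMatrix'_Lc (R : ℕ) (φ : ℝ → ℝ) (F : ℝ) :
    LinearMap.toMatrix' (Lc N R φ F) = circulant (Lc N R φ F (Pi.single 0 1)) := by
  ext i j
  rw [LinearMap.toMatrix'_apply, circulant_apply]
  simp only [Lc, LinearMap.coe_mk, AddHom.coe_mk, Pi.single_apply]
  refine Finset.sum_congr rfl fun r _ => ?_
  have h1 : i + 1 = j ↔ i - j + 1 = 0 := by
    rw [← sub_eq_zero, add_sub_right_comm]
  have h2 : i - 1 = j ↔ i - j - 1 = 0 := by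
    rw [← sub_eq_zero, sub_right_comm]
  simp only [h1, h2, sub_eq_zero (a := i) (b := j)]

theorem dft_second_difference (m k : ZMod N) :
    ∑ l : ZMod N, ZMod.stdAddChar (-(l * k)) * ((-(Pi.single 0 1 : Per N) (l + m) +
      2 * (Pi.single 0 1 : Per N) l - (Pi.single 0 1 : Per N) (l - m) : ℝ) : ℂ) =
      2 - ZMod.stdAddChar (m * k) - (ZMod.stdAddChar (m * k))⁻¹ := by
  have h1 (l : ZMod N) : l + m = 0 ↔ l = -m := eq_neg_iff_add_eq_zero.symm
  have h2 (l : ZMod N) : l - m = 0 ↔ l = m := sub_eq_zero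
  simp only [Pi.single_apply, h1, h2, Complex.ofReal_sub, Complex.ofReal_add, Complex.ofReal_neg,
    apply_ite Complex.ofReal, Complex.ofReal_one, Complex.ofReal_zero,
    Complex.ofReal_ofNat, mul_sub, mul_add, mul_neg, mul_ite, mul_one, mul_zero,
    Finset.sum_sub_distrib, Finset.sum_add_distrib, Finset.sum_neg_distrib, Finset.sum_ite_eq',
    Finset.mem_univ, if_true, neg_mul, zero_mul, AddChar.map_zero_eq_one,
    AddChar.map_neg_eq_inv, inv_inv]
  ring

theorem dft_La (R : ℕ) (φ : ℝ → ℝ) (F : ℝ) (k : ZMod N) :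
    ZMod.dft (fun l => (La N R φ F (Pi.single 0 1) l : ℂ)) k =
      ∑ r ∈ Finset.Icc 1 R, (phi2 φ F r : ℂ) *
        (2 - ZMod.stdAddChar k ^ r - (ZMod.stdAddChar k)⁻¹ ^ r) := by
  simp only [ZMod.dft_apply, La, LinearMap.coe_mk, AddHom.coe_mk, smul_eq_mul,
    Complex.ofReal_sum, Finset.mul_sum]
  rw [Finset.sum_comm]
  refine Finset.sum_congr rfl fun r _ => ?_
  rw [inv_pow, ← AddChar.map_nsmul_eq_pow, nsmul_eq_mul, ← dft_second_difference, Finset.mul_sum]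
  refine Finset.sum_congr rfl fun l _ => ?_
  rw [Complex.ofReal_mul]
  ring

theorem dft_Lc (R : ℕ) (φ : ℝ → ℝ) (F : ℝ) (k : ZMod N) :
    ZMod.dft (fun l => (Lc N R φ F (Pi.single 0 1) l : ℂ)) k =
      ∑ r ∈ Finset.Icc 1 R, (phi2 φ F r : ℂ) * (r : ℂ) ^ 2 *
        (2 - ZMod.stdAddChar k - (ZMod.stdAddChar k)⁻¹) := by
  simp only [ZMod.dft_apply, Lc, LinearMap.coe_mk, AddHom.coe_mk, smul_eq_mul,
    Complex.ofReal_sum, Finset.mul_sum]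
  rw [Finset.sum_comm]
  refine Finset.sum_congr rfl fun r _ => ?_
  have := dft_second_difference 1 k
  rw [one_mul] at this
  rw [← this, Finset.mul_sum]
  refine Finset.sum_congr rfl fun l _ => ?_
  push_cast
  ring

/-- Termwise, `(t^r - 1)(t^{-r} - 1) = 2 - t^r - t^{-r}`. Nearest neighbours contribute equally to
both operators, which is why the sum in `b` may start at `r = 2`. -/
theorem dft_La_sub_dft_Lc (R : ℕ) (φ : ℝ → ℝ) (F : ℝ) (k : ZMod N) :
    ZMod.dft (fun l => (La N R φ F (Pi.single 0 1) l : ℂ)) k -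
      ZMod.dft (fun l => (Lc N R φ F (Pi.single 0 1) l : ℂ)) k =
      b R φ F (ZMod.stdAddChar k) := by
  have ht : (ZMod.stdAddChar k : ℂ) ≠ 0 := by
    rw [← norm_ne_zero_iff, AddChar.norm_apply]; exact one_ne_zero
  rw [dft_La, dft_Lc, ← Finset.sum_sub_distrib, b]
  generalize (ZMod.stdAddChar k : ℂ) = t at ht
  have key (r : ℕ) : (phi2 φ F r : ℂ) * (2 - t ^ r - t⁻¹ ^ r) -
      (phi2 φ F r : ℂ) * (r : ℂ) ^ 2 * (2 - t - t⁻¹) =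
      (phi2 φ F r : ℂ) *
        ((t ^ r - 1) * (t⁻¹ ^ r - 1) - (r : ℂ) ^ 2 * ((t - 1) * (t⁻¹ - 1))) := by
    have h1 : t * t⁻¹ = 1 := mul_inv_cancel₀ ht
    have h2 : t ^ r * t⁻¹ ^ r = 1 := by rw [← mul_pow, h1, one_pow]
    linear_combination (phi2 φ F r : ℂ) * (r ^ 2 * h1 - h2)
  simp only [key]
  refine (Finset.sum_subset (Finset.Icc_subset_Icc_left one_le_two) fun r hr hr' => ?_).symm
  obtain rfl : r = 1 := by simp only [Finset.mem_Icc] at hr hr'; omega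
  simp

/-! ### Projection onto constants and the coupled operator -/

/-- The matrix of the orthogonal projection onto the constant sequences. -/
noncomputable def meanMatrix (N : ℕ) : Matrix (ZMod N) (ZMod N) ℝ := circulant fun _ => 1 / (N : ℝ)

theorem toMatrix'_PU : LinearMap.toMatrix' (PU N) = 1 - meanMatrix N := by
  ext i j
  simp [PU, meanMatrix, LinearMap.toMatrix'_apply, Matrix.one_apply, Pi.single_apply]

theorem dft_const_inv (k : ZMod N) :
    ZMod.dft (fun _ : ZMod N => ((1 / (N : ℝ) : ℝ) : ℂ)) k = if k = 0 then 1 else 0 := by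
  have hN : (N : ℂ) ≠ 0 := NeZero.ne _
  simp only [ZMod.dft_apply, smul_eq_mul, ← Finset.sum_mul, ← mul_neg]
  rw [AddChar.sum_mulShift _ (ZMod.isPrimitive_stdAddChar N)]
  simp only [neg_eq_zero, ZMod.card]
  split_ifs <;> simp [hN]

theorem meanMatrix_mul_self : meanMatrix N * meanMatrix N = meanMatrix N := by
  have hN : (N : ℝ) ≠ 0 := NeZero.ne _
  ext i j
  simp [meanMatrix, Matrix.mul_apply, hN]

theorem circulant_mul_meanMatrix {v : ZMod N → ℝ} (hv : ∑ k, v k = 0) :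
    circulant v * meanMatrix N = 0 := by
  ext i j
  simp only [meanMatrix, Matrix.mul_apply, circulant_apply, ← Finset.sum_mul, Matrix.zero_apply]
  have h := (Equiv.subLeft i).sum_comp v
  simp only [Equiv.subLeft_apply] at h
  rw [h, hv, zero_mul]

theorem meanMatrix_mul_circulant {v : ZMod N → ℝ} (hv : ∑ k, v k = 0) :
    meanMatrix N * circulant v = 0 := by
  rw [meanMatrix, circulant_mul_comm]
  exact circulant_mul_meanMatrix hv

/-- The sum is the Fourier symbol at frequency `0`, where `t = 1`. -/
theorem sum_La_single (R : ℕ) (φ : ℝ → ℝ) (F : ℝ) : ∑ k, La N R φ F (Pi.single 0 1) k = 0 := by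
  have h := dft_La (N := N) R φ F 0
  rw [ZMod.dft_apply_zero] at h
  rw [← Complex.ofReal_eq_zero, Complex.ofReal_sum, h]
  exact Finset.sum_eq_zero fun r _ => by simp; norm_num

theorem sum_Lc_single (R : ℕ) (φ : ℝ → ℝ) (F : ℝ) : ∑ k, Lc N R φ F (Pi.single 0 1) k = 0 := by
  have h := dft_Lc (N := N) R φ F 0
  rw [ZMod.dft_apply_zero] at h
  rw [← Complex.ofReal_eq_zero, Complex.ofReal_sum, h]
  exact Finset.sum_eq_zero fun r _ => by simp; norm_num

theorem toMatrix'_Lqcf (R : ℕ) (φ : ℝ → ℝ) (F : ℝ) (A : Set (ZMod N)) :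
    LinearMap.toMatrix' (Lqcf N R φ F A) = LinearMap.toMatrix' (Lc N R φ F) +
      diagonal (A.indicator 1) *
        (LinearMap.toMatrix' (La N R φ F) - LinearMap.toMatrix' (Lc N R φ F)) := by
  ext i j
  rw [Matrix.add_apply, diagonal_mul, Matrix.sub_apply]
  simp only [LinearMap.toMatrix'_apply]
  by_cases h : i ∈ A <;> simp [Lqcf, h]

/-- If `ε b` is positive on the unit circle away from `1`, then the spectra of the three operators
are real and interlaced according to the sign of `ε`. -/
theorem exists_spectra (R : ℕ) (φ : ℝ → ℝ) (F : ℝ) (A : Set (ZMod N)) (ε : ℝ)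
    (hb : ∀ t : ℂ, ‖t‖ = 1 → t ≠ 1 → 0 < ε * (b R φ F t).re) :
    ∃ ev eva evc : Fin N → ℝ,
      IsOrderedSpectrum (Lqcf0 N R φ F A) ev ∧
      IsOrderedSpectrum (La N R φ F) eva ∧
      IsOrderedSpectrum (Lc N R φ F) evc ∧
      (0 ≤ ε → ∀ j, evc j ≤ ev j ∧ ev j ≤ eva j) ∧
      (ε ≤ 0 → ∀ j, eva j ≤ ev j ∧ ev j ≤ evc j) := by
  set a := La N R φ F (Pi.single 0 1)
  set c := Lc N R φ F (Pi.single 0 1)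
  have hMa : LinearMap.toMatrix' (La N R φ F) = circulant a := toMatrix'_La R φ F
  have hMc : LinearMap.toMatrix' (Lc N R φ F) = circulant c := toMatrix'_Lc R φ F
  set B := circulant (a - c) with hBdef
  set J := meanMatrix N with hJdef
  set χ : Matrix (ZMod N) (ZMod N) ℝ := diagonal (A.indicator 1)
  have hBsub : B = circulant a - circulant c := by rw [hBdef, circulant_sub]
  -- At frequency `0`, `b(1) = 0` and `J` supplies `1`; at every other frequency `J` vanishes and `ε
  -- b` is positive.
  have hG : (ε • B + J).PosDef := by
    rw [hBdef, hJdef, meanMatrix, ← circulant_smul, ← circulant_add]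
    apply posDef_circulant
    · intro k
      simp only [Pi.add_apply, Pi.smul_apply, Pi.sub_apply, a, c, La_single_neg, Lc_single_neg]
    · intro k
      have hlin : ZMod.dft (fun l => ((ε • (a - c) + fun _ => 1 / (N : ℝ) : Per N) l : ℂ)) k =
          ε * b R φ F (ZMod.stdAddChar k) + if k = 0 then 1 else 0 := by
        rw [← dft_La_sub_dft_Lc, ← dft_const_inv]
        simp only [ZMod.dft_apply, smul_eq_mul, ← Finset.sum_sub_distrib, Finset.mul_sum,
          ← Finset.sum_add_distrib]
        refine Finset.sum_congr rfl fun l _ => ?_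
        simp only [Pi.add_apply, Pi.smul_apply, Pi.sub_apply, smul_eq_mul, Complex.ofReal_add,
          Complex.ofReal_mul, Complex.ofReal_sub, a, c]
        ring
      rw [hlin]
      by_cases hk : k = 0
      · subst hk
        simp [b]
      · have h1 : (ZMod.stdAddChar k : ℂ) ≠ 1 := fun h => hk <|
          ZMod.injective_stdAddChar (h.trans (AddChar.map_zero_eq_one _).symm)
        simpa [hk] using hb _ (AddChar.norm_apply _ _) h1
  have hBJ : B * J = 0 := circulant_mul_meanMatrix (by
    simp only [Pi.sub_apply, Finset.sum_sub_distrib, a, c, sum_La_single, sum_Lc_single, sub_zero])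
  have hJa : J * circulant a = 0 := meanMatrix_mul_circulant (sum_La_single R φ F)
  have hJc : J * circulant c = 0 := meanMatrix_mul_circulant (sum_Lc_single R φ F)
  have hJJ : J * J = J := meanMatrix_mul_self
  have haT : (circulant a)ᴴ = circulant a := by
    rw [conjTranspose_eq_transpose_of_trivial]
    exact circulant_isSymm_iff.2 (La_single_neg R φ F)
  have hcT : (circulant c)ᴴ = circulant c := by
    rw [conjTranspose_eq_transpose_of_trivial]
    exact circulant_isSymm_iff.2 (Lc_single_neg R φ F)
  have hBT : Bᴴ = B := by rw [hBsub, conjTranspose_sub, haT, hcT]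
  have hχT : χᴴ = χ := by simp [χ]
  have hGa : (ε • B + J) * circulant a = ε • (B * circulant a) := by
    rw [add_mul, hJa, add_zero, smul_mul_assoc]
  have hGc : (ε • B + J) * circulant c = ε • (B * circulant c) := by
    rw [add_mul, hJc, add_zero, smul_mul_assoc]
  -- `G (1 - J) = ε B` absorbs the projection and places `χ` symmetrically between two copies of
  -- `B`.
  have hG0 : (ε • B + J) * LinearMap.toMatrix' (Lqcf0 N R φ F A) =
      ε • (B * circulant c) + ε • (B * χ * B) := by
    rw [Lqcf0, LinearMap.toMatrix'_comp, toMatrix'_PU, toMatrix'_Lqcf, hMa, hMc, ← hBsub,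
      ← mul_assoc]
    rw [mul_sub, mul_one, add_mul, smul_mul_assoc, hBJ, hJJ, smul_zero, zero_add, add_sub_cancel_right,
      mul_add, smul_mul_assoc, smul_mul_assoc, ← mul_assoc]
  have hle1 : (B * χ * B).PosSemidef := by
    have : χ.PosSemidef := PosSemidef.diagonal (Set.indicator_nonneg fun _ _ => zero_le_one)
    simpa only [hBT] using this.conjTranspose_mul_mul_same B
  -- The matrix equals `B (1 - χ) B`, since `B` is the difference of the two circulants.
  have hle2 : (B * circulant a - B * circulant c - B * χ * B).PosSemidef := by
    have : (1 - χ).PosSemidef := by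
      rw [← diagonal_one, diagonal_sub]
      exact PosSemidef.diagonal fun i => sub_nonneg.2
        (Set.indicator_le_self' (fun _ _ => zero_le_one) i)
    have := this.conjTranspose_mul_mul_same B
    rw [hBT, mul_sub, sub_mul, mul_one] at this
    rwa [← mul_sub, ← hBsub]
  obtain ⟨ev, hspec, hmono⟩ := exists_isOrderedSpectrum hG
    ![Lqcf0 N R φ F A, La N R φ F, Lc N R φ F] (by
      have h2 : (ε • (B * circulant c)).IsHermitian := by
        rw [IsHermitian, conjTranspose_smul, conjTranspose_mul, hBT, hcT, star_trivial, hBdef,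
          circulant_mul_comm]
      intro i
      fin_cases i
      · change ((ε • B + J) * LinearMap.toMatrix' (Lqcf0 N R φ F A)).IsHermitian
        rw [hG0]
        refine h2.add ?_
        rw [IsHermitian, conjTranspose_smul, hle1.1.eq, star_trivial]
      · change ((ε • B + J) * LinearMap.toMatrix' (La N R φ F)).IsHermitian
        rw [hMa, hGa, IsHermitian, conjTranspose_smul, conjTranspose_mul, hBT, haT, star_trivial,
          hBdef, circulant_mul_comm]
      · change ((ε • B + J) * LinearMap.toMatrix' (Lc N R φ F)).IsHermitian
        rwa [hMc, hGc])
  refine ⟨ev 0, ev 1, ev 2, hspec 0, hspec 1, hspec 2, fun hε j => ⟨hmono 2 0 ?_ j, hmono 0 1 ?_ j⟩,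
    fun hε j => ⟨hmono 1 0 ?_ j, hmono 0 2 ?_ j⟩⟩ <;>
    simp only [Matrix.cons_val_zero, Matrix.cons_val_one, Matrix.cons_val, hMa, hMc, hGa, hGc, hG0]
  · rw [add_sub_cancel_left]
    exact hle1.smul hε
  · have := hle2.smul hε
    rwa [smul_sub, smul_sub, sub_sub] at this
  · have := hle2.smul (neg_nonneg.2 hε)
    convert this using 1
    module
  · have := hle1.smul (neg_nonneg.2 hε)
    convert this using 1
    module

/-! ### The sign of `b` on the unit circle -/

theorem b_ne_zero_of_b1_ne_zero {R : ℕ} {φ : ℝ → ℝ} {F : ℝ} {t : ℂ} (ht : t ≠ 1)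
    (h : b1 R φ F t ≠ 0) : b R φ F t ≠ 0 := by
  rw [b1, Function.update_of_ne ht, bQuot] at h
  exact fun h0 => h (by rw [h0, zero_div])

/-- If `b` has no zeros on the unit circle away from `1`, then it has constant sign there. -/
theorem b_pos_or_neg {R : ℕ} {φ : ℝ → ℝ} {F : ℝ}
    (h : ∀ t : ℂ, ‖t‖ = 1 → t ≠ 1 → b R φ F t ≠ 0) :
    (∀ t : ℂ, ‖t‖ = 1 → t ≠ 1 → 0 < (b R φ F t).re) ∨
      (∀ t : ℂ, ‖t‖ = 1 → t ≠ 1 → (b R φ F t).re < 0) := by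
  let f : ℝ → ℝ := fun θ => (b R φ F (Complex.exp (θ * Complex.I))).re
  have hf : Continuous f := by
    have (θ : ℝ) : (Complex.exp (θ * Complex.I))⁻¹ = Complex.exp (-(θ * Complex.I)) :=
      (Complex.exp_neg _).symm
    simp only [f, b, this]
    fun_prop
  have hparam (t : ℂ) (ht : ‖t‖ = 1) (ht1 : t ≠ 1) :
      ∃ θ ∈ Set.Ioo 0 (2 * Real.pi), t = Complex.exp (θ * Complex.I) := by
    -- Using the argument of `-t` moves the branch cut to the excluded point `t = 1`, so the
    -- punctured circle becomes one open interval.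
    refine ⟨(-t).arg + Real.pi, ⟨?_, ?_⟩, ?_⟩
    · linarith [Complex.neg_pi_lt_arg (-t)]
    · have : (-t).arg ≠ Real.pi := fun harg => ht1 <| by
        have h1 := Complex.norm_mul_exp_arg_mul_I (-t)
        rw [harg, norm_neg, ht, Complex.exp_pi_mul_I] at h1
        simpa using h1.symm
      linarith [lt_of_le_of_ne (Complex.arg_le_pi (-t)) this]
    · have h1 := Complex.norm_mul_exp_arg_mul_I (-t)
      rw [norm_neg, ht, Complex.ofReal_one, one_mul] at h1
      rw [Complex.ofReal_add, add_mul, Complex.exp_add, h1, Complex.exp_pi_mul_I]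
      ring
  have hne1 (θ : ℝ) (hθ : θ ∈ Set.Ioo 0 (2 * Real.pi)) : Complex.exp (θ * Complex.I) ≠ 1 := by
    intro h1
    obtain ⟨n, hn⟩ := Complex.exp_eq_one_iff.1 h1
    have h2 : θ = n * (2 * Real.pi) := by
      have : (θ : ℂ) = n * (2 * Real.pi) := mul_right_cancel₀ Complex.I_ne_zero (by rw [hn]; ring)
      exact_mod_cast this
    rw [h2] at hθ
    have hpi := Real.two_pi_pos
    have h3 : (0 : ℝ) < n := pos_of_mul_pos_left hθ.1 hpi.le
    have h4 : (n : ℝ) < 1 := by nlinarith [hθ.2]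
    norm_cast at h3 h4
    omega
  have hf0 : ∀ θ ∈ Set.Ioo 0 (2 * Real.pi), f θ ≠ 0 := fun θ hθ h0 =>
    h _ (Complex.norm_exp_ofReal_mul_I θ) (hne1 θ hθ)
      (Complex.ext h0 (b_im R φ F _ (Complex.norm_exp_ofReal_mul_I θ)))
  by_contra! hcon
  obtain ⟨⟨t, ht, ht1, hbt⟩, s, hs, hs1, hbs⟩ := hcon
  obtain ⟨θ, hθ, rfl⟩ := hparam t ht ht1
  obtain ⟨η, hη, rfl⟩ := hparam s hs hs1
  obtain ⟨ξ, hξ, hξ0⟩ := (isPreconnected_Ioo (a := (0 : ℝ)) (b := 2 * Real.pi)).intermediate_value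
    hθ hη hf.continuousOn ⟨hbt, hbs⟩
  exact hf0 ξ hξ hξ0

end QCF

theorem theorem4p9 (N : ℕ) [NeZero N] (R : ℕ) (hR : 2 ≤ R)
    (φ : ℝ → ℝ) (hφ : ContDiffOn ℝ 2 φ (Set.Ioi 0)) (F : ℝ) (hF : 0 < F)
    (A : Set (ZMod N)) (β₀ β₁ : ℝ) (hβ₀ : 0 < β₀) (hβ₁ : 0 < β₁)
    (hb₁ : ∀ t : ℂ, ‖t‖ = 1 → β₀ ^ 2 ≤ ‖QCF.b1 R φ F t‖ ∧ ‖QCF.b1 R φ F t‖ ≤ β₁ ^ 2) :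
    ∃ ev eva evc : Fin N → ℝ,
      QCF.IsOrderedSpectrum (QCF.Lqcf0 N R φ F A) ev ∧
      QCF.IsOrderedSpectrum (QCF.La N R φ F) eva ∧
      QCF.IsOrderedSpectrum (QCF.Lc N R φ F) evc ∧
      ((∀ t : ℂ, ‖t‖ = 1 → 0 ≤ (QCF.b R φ F t).re) → ∀ j, evc j ≤ ev j ∧ ev j ≤ eva j) ∧
      ((∀ t : ℂ, ‖t‖ = 1 → (QCF.b R φ F t).re ≤ 0) → ∀ j, eva j ≤ ev j ∧ ev j ≤ evc j) := by
  have hb : ∀ t : ℂ, ‖t‖ = 1 → t ≠ 1 → QCF.b R φ F t ≠ 0 := fun t ht ht1 =>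
    QCF.b_ne_zero_of_b1_ne_zero ht1 (norm_pos_iff.1 ((by positivity : 0 < β₀ ^ 2).trans_le
      (hb₁ t ht).1))
  -- The point `-1` refutes whichever sign hypothesis disagrees with the actual sign of `b`.
  have hn : ‖(-1 : ℂ)‖ = 1 := by simp
  have hn1 : (-1 : ℂ) ≠ 1 := by norm_num
  rcases QCF.b_pos_or_neg hb with h | h
  · obtain ⟨ev, eva, evc, h1, h2, h3, h4, -⟩ := QCF.exists_spectra (N := N) R φ F A 1
      (by simpa using h)
    exact ⟨ev, eva, evc, h1, h2, h3, fun _ => h4 zero_le_one,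
      fun h' => absurd (h' _ hn) (h _ hn hn1).not_ge⟩
  · obtain ⟨ev, eva, evc, h1, h2, h3, -, h4⟩ := QCF.exists_spectra (N := N) R φ F A (-1)
      (by simpa using h)
    exact ⟨ev, eva, evc, h1, h2, h3, fun h' => absurd (h' _ hn) (h _ hn hn1).not_ge,
      fun _ => h4 (by norm_num)⟩
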